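/- Let $\mathbf{k}$ be any field, $n\ge 0$ and $d\ge 1$ integers, and $b,q\in\mathbf{Z}$. Let $S=\mathbf{k}[x_0,\dots,x_n]$ and $\overline{S}=S/(x_0^d,\dots,x_n^d)$, with graded pieces $S_j,\overline{S}_j$ ($j\in\mathbf{Z}$, zero for $j<0$). For $A=S$ or $A=\overline{S}$ consider the Koszul complex \[ \cdots\to\textstyle\bigwedge^{p+1}A_d\otimes A_{(q-1)d+b}\xrightarrow{\partial_{p+1}}\bigwedge^{p}A_d\otimes A_{qd+b}\xrightarrow{\partial_p}\bigwedge^{p-1}A_d\otimes A_{(q+1)d+b}\to\cdots,\] \[ \partial_p(v_1\wedge\dots\wedge v_p\otimes m)=\sum_{i=1}^{p}(-1)^{i-1}\,v_1\wedge\dots\widehat{v_i}\dots\wedge v_p\otimes v_im,\] (tensor and exterior powers over $\mathbf{k}$, with $\bigwedge^{-1}=0$). For $A=S$, its cohomology at the term $\bigwedge^{p}S_d\otimes S_{qd+b}$ is denoted $K_{p,q}(n,b;d)$. A monomial of $\overline{S}$ is a nonzero image of a monomial of $S$. Let $f\in\overline{S}_{qd+b}$ be a monomial, let $D_f\subseteq\overline{S}_d$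 be the set of monomials of degree $d$ that divide $f$ in $\overline{S}$, and let $Z_f\subseteq\overline{S}_d$ be the set of monomials $m$ of degree $d$ with $mf=0$. Suppose that $D_f\subseteq Z_f$. Write $\det D_f$ for the wedge product of all elements of $D_f$, in any fixed order. Then for all $s\ge 0$ and all $\zeta=m_1\wedge\dots\wedge m_s$ with $m_1,\dots,m_s\in Z_f$ such that the element \[ (\det D_f\wedge\zeta)\otimes f\ \in\ \textstyle\bigwedge^{|D_f|+s}\overline{S}_d\otimes\overline{S}_{qd+b}\] is nonzero, this element is a cycle of the Koszul complex of $\overline{S}$, and its class in the cohomology at $\bigwedge^{|D_f|+s}\overline{S}_d\otimes\overline{S}_{qd+b}$ is nonzero. Moreover $K_{p,q}(n,b;d)\ne 0$ for every integer $p$ with $|D_f|\le p\le|Z_f|$. -/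

import Mathlib

open scoped TensorProduct

noncomputable section

namespace Veronese

/-! ### Exterior powers -/

section Wedge

variable (k V : Type*) [CommRing k] [AddCommGroup V] [Module k V] (p : ℕ)

/-- The exterior power `⋀^p V`: Mathlib's `⋀[k]^p V`, as a type of its own. -/
def Wedge : Type _ := ⋀[k]^p V

instance : AddCommGroup (Wedge k V p) := inferInstanceAs (AddCommGroup (⋀[k]^p V))

instance : Module k (Wedge k V p) := inferInstanceAs (Module k (⋀[k]^p V))

variable {V}

/-- The wedge product `(v_1, …, v_p) ↦ v_1 ∧ ⋯ ∧ v_p`. -/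
def wedge : V [⋀^Fin p]→ₗ[k] Wedge k V p := exteriorPower.ιMulti k p

variable {k p}
variable {N : Type*} [AddCommGroup N] [Module k N]

/-- The linear map on `⋀^p V` induced by an alternating map. -/
def wedgeLift (g : V [⋀^Fin p]→ₗ[k] N) : Wedge k V p →ₗ[k] N :=
  exteriorPower.alternatingMapLinearEquiv g

@[simp]
theorem wedgeLift_wedge (g : V [⋀^Fin p]→ₗ[k] N) (v : Fin p → V) :
    wedgeLift g (wedge k p v) = g v :=
  exteriorPower.alternatingMapLinearEquiv_apply_ιMulti g v

theorem wedge_hom_ext {f g : Wedge k V p →ₗ[k] N} (h : ∀ v, f (wedge k p v) = g (wedge k p v)) :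
    f = g :=
  exteriorPower.linearMap_ext (AlternatingMap.ext h)

end Wedge

/-! ### Koszul complexes -/

section Koszul

variable {k V M N P : Type*} [CommRing k] [AddCommGroup V] [Module k V]
  [AddCommGroup M] [Module k M] [AddCommGroup N] [Module k N] [AddCommGroup P] [Module k P]

/-- For a bilinear map `μ : V × M → N`, the map sending `v` and `(w_1, …, w_p)` to the
linear map `m ↦ (w_1 ∧ ⋯ ∧ w_p) ⊗ μ v m`. -/
def koszulAux (μ : V →ₗ[k] M →ₗ[k] N) (p : ℕ) :
    V →ₗ[k] V [⋀^Fin p]→ₗ[k] (M →ₗ[k] Wedge k V p ⊗[k] N) where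
  toFun v := LinearMap.compAlternatingMap
    ((LinearMap.lcomp k (Wedge k V p ⊗[k] N) (μ v)) ∘ₗ TensorProduct.mk k (Wedge k V p) N)
    (wedge k p)
  map_add' v w := by ext; simp [TensorProduct.tmul_add]
  map_smul' c v := by ext; simp

/-- The Koszul differential `⋀^{p+1} V ⊗ M → ⋀^p V ⊗ N` of a bilinear map `μ : V × M → N`. Its
value on pure wedges is given by `koszulDifferential_wedge_tmul`. -/
def koszulDifferential (μ : V →ₗ[k] M →ₗ[k] N) (p : ℕ) :
    Wedge k V (p + 1) ⊗[k] M →ₗ[k] Wedge k V p ⊗[k] N :=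
  TensorProduct.lift (wedgeLift (AlternatingMap.alternatizeUncurryFin (koszulAux μ p)))

/-- `(v_0 ∧ ⋯ ∧ v_p) ⊗ m ↦ ∑ i, (-1)^i (v_0 ∧ ⋯ (omit v_i) ⋯ ∧ v_p) ⊗ μ v_i m`. -/
theorem koszulDifferential_wedge_tmul (μ : V →ₗ[k] M →ₗ[k] N) (p : ℕ)
    (v : Fin (p + 1) → V) (m : M) :
    koszulDifferential μ p (wedge k (p + 1) v ⊗ₜ m) =
      ∑ i : Fin (p + 1), (-1 : ℤ) ^ (i : ℕ) • (wedge k p (i.removeNth v) ⊗ₜ[k] μ (v i) m) := by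
  simp [koszulDifferential, AlternatingMap.alternatizeUncurryFin_apply, koszulAux]

/-- Two successive Koszul differentials compose to zero if the multiplications commute. -/
theorem koszulDifferential_comp (μ : V →ₗ[k] M →ₗ[k] N) (ν : V →ₗ[k] N →ₗ[k] P)
    (h : ∀ v w m, ν v (μ w m) = ν w (μ v m)) (p : ℕ) :
    koszulDifferential ν p ∘ₗ koszulDifferential μ (p + 1) = 0 := by
  refine TensorProduct.ext (wedge_hom_ext fun v => LinearMap.ext fun m => ?_)
  let F : V →ₗ[k] V →ₗ[k] V [⋀^Fin p]→ₗ[k] (M →ₗ[k] Wedge k V p ⊗[k] P) :=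
    LinearMap.mk₂ k (fun x y => LinearMap.compAlternatingMap
        ((LinearMap.lcomp k (Wedge k V p ⊗[k] P) (ν y ∘ₗ μ x)) ∘ₗ
          TensorProduct.mk k (Wedge k V p) P) (wedge k p))
      (fun x x' y => by ext; simp [TensorProduct.tmul_add])
      (fun c x y => by ext; simp)
      (fun x y y' => by ext; simp [TensorProduct.tmul_add])
      (fun c x y => by ext; simp)
  have hF : ∀ x y, F x y = F y x := fun x y => by ext; simp [F, h]
  have key := congrArg (fun g => g v m)
    (AlternatingMap.alternatizeUncurryFin_alternatizeUncurryFinLM_comp_of_symmetric hF)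
  simp only [AlternatingMap.alternatizeUncurryFin_apply, LinearMap.coe_comp, Function.comp_apply,
    AlternatingMap.alternatizeUncurryFinLM_apply] at key
  change koszulDifferential ν p (koszulDifferential μ (p + 1) (wedge k (p + 2) v ⊗ₜ m)) = 0
  simp only [koszulDifferential_wedge_tmul, map_sum, map_zsmul]
  simpa [F, LinearMap.sum_apply] using key

end Koszul

/-! ### Koszul cohomology of a twisted Veronese module -/

section Cohomology

variable {k A : Type*} [Field k] [CommRing A] [Algebra k A]
  (𝒜 : ℤ → Submodule k A) [SetLike.GradedMonoid 𝒜]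

/-- Multiplication `𝒜 i × 𝒜 j → 𝒜 l` for `i + j = l`. -/
def gradedMul {i j l : ℤ} (h : i + j = l) : 𝒜 i →ₗ[k] 𝒜 j →ₗ[k] 𝒜 l :=
  LinearMap.mk₂ k (fun x y => ⟨(x : A) * y, h ▸ SetLike.mul_mem_graded x.2 y.2⟩)
    (fun x x' y => Subtype.ext (by simp [add_mul]))
    (fun c x y => Subtype.ext (by simp))
    (fun x y y' => Subtype.ext (by simp [mul_add]))
    (fun c x y => Subtype.ext (by simp))

variable (d : ℕ) (b : ℤ)

/-- The term `⋀^p 𝒜_d ⊗ 𝒜_{qd+b}` of the Koszul complex. -/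
abbrev KoszulTerm (p : ℕ) (q : ℤ) : Type _ :=
  Wedge k (𝒜 (d : ℤ)) p ⊗[k] 𝒜 (q * d + b)

/-- The differential `⋀^{p+1} 𝒜_d ⊗ 𝒜_{qd+b} → ⋀^p 𝒜_d ⊗ 𝒜_{q'd+b}`, where `q' = q + 1`. -/
def koszulD (p : ℕ) {q q' : ℤ} (h : q + 1 = q') :
    KoszulTerm 𝒜 d b (p + 1) q →ₗ[k] KoszulTerm 𝒜 d b p q' :=
  koszulDifferential (gradedMul 𝒜 (by subst h; ring)) p

/-- The kernel of `∂_p : ⋀^p 𝒜_d ⊗ 𝒜_{qd+b} → ⋀^{p-1} 𝒜_d ⊗ 𝒜_{(q+1)d+b}`;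
the target is `0` when `p = 0`. -/
def koszulCycles : (p : ℕ) → (q : ℤ) → Submodule k (KoszulTerm 𝒜 d b p q)
  | 0, _ => ⊤
  | p + 1, _ => LinearMap.ker (koszulD 𝒜 d b p rfl)

/-- The image of `∂_{p+1} : ⋀^{p+1} 𝒜_d ⊗ 𝒜_{(q-1)d+b} → ⋀^p 𝒜_d ⊗ 𝒜_{qd+b}`. -/
def koszulBoundaries (p : ℕ) (q : ℤ) : Submodule k (KoszulTerm 𝒜 d b p q) :=
  LinearMap.range (koszulD 𝒜 d b p (sub_add_cancel q 1))

/-- Boundaries are cycles. -/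
theorem koszulBoundaries_le_koszulCycles (p : ℕ) (q : ℤ) :
    koszulBoundaries 𝒜 d b p q ≤ koszulCycles 𝒜 d b p q := by
  cases p with
  | zero => exact le_top
  | succ p =>
    exact LinearMap.range_le_ker_iff.2 (koszulDifferential_comp (gradedMul 𝒜 _) (gradedMul 𝒜 _)
      (fun v w m => Subtype.ext (mul_left_comm (v : A) w m)) p)

/-- The Koszul cohomology `K_{p,q}` of the graded module `⨁_j 𝒜_{jd+b}` with respect to `𝒜_d`:
the cohomology at `⋀^p 𝒜_d ⊗ 𝒜_{qd+b}` of the Koszul complex. -/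
abbrev KoszulCohomology (p : ℕ) (q : ℤ) : Type _ :=
  koszulCycles 𝒜 d b p q ⧸ (koszulBoundaries 𝒜 d b p q).submoduleOf (koszulCycles 𝒜 d b p q)

/-- An element of `⋀^p 𝒜_d ⊗ 𝒜_{qd+b}` represents a nonzero Koszul cohomology class if it is a
cycle and its class in the cohomology group is not zero. -/
def RepresentsNonzeroClass {p : ℕ} {q : ℤ} (x : KoszulTerm 𝒜 d b p q) : Prop :=
  ∃ hx : x ∈ koszulCycles 𝒜 d b p q,
    (Submodule.Quotient.mk ⟨x, hx⟩ : KoszulCohomology 𝒜 d b p q) ≠ 0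

end Cohomology

/-! ### The polynomial ring and its truncation -/

section Rings

variable (k : Type*) [Field k] (n : ℕ)

/-- The graded pieces `S_j`, `j ∈ ℤ`, of `S = k[x_0, …, x_n]` for the usual degree (so `S_j = 0`
for `j < 0`). -/
abbrev polyGrading : ℤ → Submodule k (MvPolynomial (Fin (n + 1)) k) :=
  MvPolynomial.weightedHomogeneousSubmodule k (fun _ : Fin (n + 1) => (1 : ℤ))

instance : SetLike.GradedMonoid (polyGrading k n) :=
  MvPolynomial.WeightedHomogeneousSubmodule.gradedMonoid

/-- The Koszul cohomology group `K_{p,q}(n,b;d)` of `S(b)^{(d)}` over `Sym(S_d)`. -/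
abbrev VeroneseKoszul (b : ℤ) (d : ℕ) (p : ℕ) (q : ℤ) : Type _ :=
  KoszulCohomology (polyGrading k n) d b p q

variable (d : ℕ)

/-- The ideal `(x_0^d, …, x_n^d)` of `S`. -/
def powerIdeal : Ideal (MvPolynomial (Fin (n + 1)) k) :=
  Ideal.span (Set.range fun i : Fin (n + 1) => (MvPolynomial.X i : MvPolynomial (Fin (n + 1)) k) ^ d)

/-- The ring `S̄ = S/(x_0^d, …, x_n^d)`. -/
abbrev TruncRing : Type _ := MvPolynomial (Fin (n + 1)) k ⧸ powerIdeal k n d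

/-- The graded piece `S̄_j`, the image of `S_j`. -/
def truncGrading (j : ℤ) : Submodule k (TruncRing k n d) :=
  (polyGrading k n j).map (Ideal.Quotient.mkₐ k (powerIdeal k n d)).toLinearMap

instance : SetLike.GradedMonoid (truncGrading k n d) where
  one_mem := ⟨1, SetLike.GradedOne.one_mem (A := polyGrading k n), map_one (Ideal.Quotient.mkₐ k (powerIdeal k n d))⟩
  mul_mem := by
    rintro i j _ _ ⟨x, hx, rfl⟩ ⟨y, hy, rfl⟩
    exact ⟨x * y, SetLike.mul_mem_graded hx hy, map_mul (Ideal.Quotient.mkₐ k (powerIdeal k n d)) x y⟩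

variable {k n d}

/-- The monomials of `S̄`: the nonzero images of monomials `x_0^{e_0} ⋯ x_n^{e_n}` of `S`. -/
def IsMonomial (f : TruncRing k n d) : Prop :=
  f ≠ 0 ∧ ∃ e : Fin (n + 1) →₀ ℕ,
    f = Ideal.Quotient.mk (powerIdeal k n d) (MvPolynomial.monomial e 1)

/-- `D_f`: the degree `d` monomials of `S̄` that divide `f`. -/
def divisorMonomials (f : TruncRing k n d) : Set (truncGrading k n d d) :=
  {m | IsMonomial (m : TruncRing k n d) ∧ (m : TruncRing k n d) ∣ f}

/-- `Z_f`: the degree `d` monomials of `S̄` that annihilate `f`. -/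
def annihilatorMonomials (f : TruncRing k n d) : Set (truncGrading k n d d) :=
  {m | IsMonomial (m : TruncRing k n d) ∧ (m : TruncRing k n d) * f = 0}

end Rings

end Veronese

end

/-! Let `m` list distinct degree `d` monomials containing `D_f`, and let `ℓ_i`, `c` be the
functionals on `S̄` reading off the coefficients of `m_i` and `f`. If `c (v g) ≠ 0`, a monomial of
`v` must divide `f`, so `v ↦ c (v g)` is a combination of coefficient functionals of elements of
`D_f`, hence of the `ℓ_i`. This makes `det (ℓ_i) ⊗ c` vanish on boundaries
(`detFunctional_koszulDifferential`), while its value on `m_1 ∧ ⋯ ∧ m_p ⊗ f` is 1. That element is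
therefore not a boundary (`wedge_tmul_notMem_koszulBoundaries`); it is a cycle when every `m_i`
kills `f`.

For `K_{p,q}`, choose the set of the `m_i` between `D_f` and `Z_f`. In `S` some `X_i = x_{j_i}^d`
divides `m_i f`, and formally expanding `f ∏ (m_i - X_i · (m_i / X_i))`, with one factor of each
product in the wedge and the other in the coefficient, gives a cycle over `S` lifting `m_1 ∧ ⋯ ∧ m_p
⊗ f` (`exists_cycle_lift`). Boundaries project to boundaries, so the lift is not a boundary. -/

noncomputable section

namespace Veronese

/-! ### Naturality of the Koszul differential -/

section Naturality

variable {k V V' M M' N N' : Type*} [CommRing k] [AddCommGroup V] [Module k V]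
  [AddCommGroup V'] [Module k V'] [AddCommGroup M] [Module k M] [AddCommGroup M'] [Module k M']
  [AddCommGroup N] [Module k N] [AddCommGroup N'] [Module k N']

/-- The map `⋀^p V → ⋀^p V'` induced by a linear map `V → V'`. -/
def wedgeMap (φ : V →ₗ[k] V') (p : ℕ) : Wedge k V p →ₗ[k] Wedge k V' p :=
  wedgeLift ((wedge k p).compLinearMap φ)

@[simp]
theorem wedgeMap_wedge (φ : V →ₗ[k] V') (p : ℕ) (v : Fin p → V) :
    wedgeMap φ p (wedge k p v) = wedge k p (fun i => φ (v i)) := by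
  rw [wedgeMap, wedgeLift_wedge]
  rfl

theorem wedgeMap_id (p : ℕ) : wedgeMap (LinearMap.id : V →ₗ[k] V) p = LinearMap.id :=
  wedge_hom_ext fun v => by simp

/-- This serves two changes of coefficients: multiplication by a fixed polynomial, and the
projection from `S` to `S̄`. -/
theorem koszulDifferential_map (μ : V →ₗ[k] M →ₗ[k] N) (μ' : V' →ₗ[k] M' →ₗ[k] N')
    (φ : V →ₗ[k] V') (ψ : M →ₗ[k] M') (χ : N →ₗ[k] N')
    (h : ∀ v m, χ (μ v m) = μ' (φ v) (ψ m)) (p : ℕ) (x : Wedge k V (p + 1) ⊗[k] M) :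
    koszulDifferential μ' p (TensorProduct.map (wedgeMap φ (p + 1)) ψ x) =
      TensorProduct.map (wedgeMap φ p) χ (koszulDifferential μ p x) := by
  suffices H : koszulDifferential μ' p ∘ₗ TensorProduct.map (wedgeMap φ (p + 1)) ψ =
      TensorProduct.map (wedgeMap φ p) χ ∘ₗ koszulDifferential μ p from LinearMap.congr_fun H x
  refine TensorProduct.ext (wedge_hom_ext fun v => LinearMap.ext fun m => ?_)
  change koszulDifferential μ' p (TensorProduct.map (wedgeMap φ (p + 1)) ψ
    (wedge k (p + 1) v ⊗ₜ m)) =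
      TensorProduct.map (wedgeMap φ p) χ (koszulDifferential μ p (wedge k (p + 1) v ⊗ₜ m))
  simp only [TensorProduct.map_tmul, wedgeMap_wedge, koszulDifferential_wedge_tmul,
    map_sum, map_zsmul, h]
  rfl

end Naturality

/-! ### Cycles and functionals -/

section Cycles

variable {k V M N : Type*} [CommRing k] [AddCommGroup V] [Module k V]
  [AddCommGroup M] [Module k M] [AddCommGroup N] [Module k N]

theorem koszulDifferential_eq_zero_of_annihilate (μ : V →ₗ[k] M →ₗ[k] N) (p : ℕ)
    (v : Fin (p + 1) → V) (m : M) (h : ∀ i, μ (v i) m = 0) :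
    koszulDifferential μ p (wedge k (p + 1) v ⊗ₜ m) = 0 := by
  simp [koszulDifferential_wedge_tmul, h]

/-- The expansion of `(u_0 v_0 - v_0 u_0) ∧ ⋯ ∧ (u_p v_p - v_p u_p) ⊗ f`, where the first factor
of each product is a scalar and the second a vector, is a Koszul cycle. -/
theorem koszulDifferential_sum_ite {A : Type*} [CommRing A] [Algebra k A]
    (φ : V →ₗ[k] A) (p : ℕ) (u v : Fin (p + 1) → V) (f : A) :
    koszulDifferential ((LinearMap.mul k A).comp φ) p
      (∑ I : Finset (Fin (p + 1)), (-1 : ℤ) ^ I.card •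
        (wedge k (p + 1) (fun i => if i ∈ I then u i else v i) ⊗ₜ[k]
          (f * ∏ i, if i ∈ I then φ (v i) else φ (u i)))) = 0 := by
  simp only [map_sum, map_zsmul, koszulDifferential_wedge_tmul, Finset.smul_sum]
  rw [Finset.sum_comm]
  refine Finset.sum_eq_zero fun i _ => ?_
  -- For a fixed omitted position `i`, the terms of `I` and `insert i I` with `i ∉ I` cancel: both
  -- have the same wedge and the same coefficient, which contains `φ (u i) * φ (v i)`, but opposite
  -- signs.
  have hb : ∀ F : Finset (Fin (p + 1)) → Wedge k V p ⊗[k] A,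
      ∑ I with ¬ i ∉ I, F I = ∑ I with i ∉ I, F (insert i I) := by
    intro F
    refine Finset.sum_bij' (fun I _ => I.erase i) (fun I _ => insert i I) ?_ ?_ ?_ ?_ ?_
    · simp
    · simp
    · intro I hI
      simp only [Finset.mem_filter, not_not] at hI
      simp [hI.2]
    · intro I hI
      simp only [Finset.mem_filter] at hI
      simp [hI.2]
    · intro I hI
      simp only [Finset.mem_filter, not_not] at hI
      simp [hI.2]
  rw [← Finset.sum_filter_add_sum_filter_not _ (fun I : Finset (Fin (p + 1)) => i ∉ I), hb,
    ← Finset.sum_add_distrib]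
  refine Finset.sum_eq_zero fun I hI => ?_
  have hi : i ∉ I := (Finset.mem_filter.1 hI).2
  have h1 : i.removeNth (fun j => if j ∈ insert i I then u j else v j) =
      i.removeNth (fun j => if j ∈ I then u j else v j) := by
    funext j
    simp [Fin.removeNth, Fin.succAbove_ne]
  have h2 : (∏ l, if l ∈ insert i I then φ (v l) else φ (u l)) =
      φ (v i) * ∏ l : Fin p, if i.succAbove l ∈ I then φ (v (i.succAbove l))
        else φ (u (i.succAbove l)) := by
    rw [Fin.prod_univ_succAbove _ i]
    simp [Fin.succAbove_ne]
  have h3 : (∏ l, if l ∈ I then φ (v l) else φ (u l)) =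
      φ (u i) * ∏ l : Fin p, if i.succAbove l ∈ I then φ (v (i.succAbove l))
        else φ (u (i.succAbove l)) := by
    rw [Fin.prod_univ_succAbove _ i]
    simp [hi]
  rw [h1, h2, h3, Finset.card_insert_of_notMem hi, pow_succ, mul_neg_one, neg_smul,
    ← sub_eq_add_neg, sub_eq_zero]
  simp only [hi, if_false, Finset.mem_insert_self, if_true,
    LinearMap.comp_apply, LinearMap.mul_apply']
  congr 3
  ring

/-- The alternating form `v ↦ det (ℓ_a (v_b))`. -/
def detForm {p : ℕ} (l : Fin p → V →ₗ[k] k) : V [⋀^Fin p]→ₗ[k] k :=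
  (Matrix.detRowAlternating (R := k) (n := Fin p)).compLinearMap (LinearMap.pi l)

theorem detForm_apply {p : ℕ} (l : Fin p → V →ₗ[k] k) (v : Fin p → V) :
    detForm l v = Matrix.det (Matrix.of fun b a => l a (v b)) := rfl

/-- This is the Laplace expansion along column 0 of the square matrix obtained by prepending a
second copy of column `a`, whose determinant is zero. -/
theorem sum_detForm_removeNth_mul {p : ℕ} (l : Fin p → V →ₗ[k] k) (w : Fin (p + 1) → V)
    (a : Fin p) :
    ∑ i : Fin (p + 1), (-1 : k) ^ (i : ℕ) * (detForm l (i.removeNth w) * l a (w i)) = 0 := by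
  have h := Matrix.det_succ_column_zero
    (Matrix.of fun b => Fin.cons (α := fun _ => k) (l a (w b)) fun c => l c (w b))
  rw [Matrix.det_zero_of_column_eq (i := 0) (j := a.succ) (Fin.succ_ne_zero a).symm
    (fun b => by simp)] at h
  rw [h]
  refine Finset.sum_congr rfl fun i _ => ?_
  rw [detForm_apply]
  simp only [Matrix.of_apply, Fin.cons_zero]
  rw [mul_assoc, mul_comm (l a (w i))]
  rfl

/-- The functional `det (ℓ_a) ⊗ c` on `⋀^p V ⊗ M`. -/
def detFunctional {p : ℕ} (l : Fin p → V →ₗ[k] k) (c : M →ₗ[k] k) :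
    Wedge k V p ⊗[k] M →ₗ[k] k :=
  TensorProduct.lift ((LinearMap.mul k k).compl₁₂ (wedgeLift (detForm l)) c)

theorem detFunctional_wedge_tmul {p : ℕ} (l : Fin p → V →ₗ[k] k) (c : M →ₗ[k] k)
    (v : Fin p → V) (m : M) :
    detFunctional l c (wedge k p v ⊗ₜ m) = detForm l v * c m := by
  simp [detFunctional]

/-- If `v ↦ c (v m)` is for every `m` a combination of the `ℓ_a`, then `det (ℓ_a) ⊗ c` vanishes
on boundaries. -/
theorem detFunctional_koszulDifferential {p : ℕ} (μ : V →ₗ[k] M →ₗ[k] N)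
    (l : Fin p → V →ₗ[k] k) (c : N →ₗ[k] k)
    (h : ∀ m, ∃ r : Fin p → k, ∀ v, c (μ v m) = ∑ a, r a * l a v)
    (x : Wedge k V (p + 1) ⊗[k] M) :
    detFunctional l c (koszulDifferential μ p x) = 0 := by
  suffices H : detFunctional l c ∘ₗ koszulDifferential μ p = 0 from LinearMap.congr_fun H x
  refine TensorProduct.ext (wedge_hom_ext fun v => LinearMap.ext fun m => ?_)
  obtain ⟨r, hr⟩ := h m
  change detFunctional l c (koszulDifferential μ p (wedge k (p + 1) v ⊗ₜ m)) = 0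
  simp only [koszulDifferential_wedge_tmul, map_sum, map_zsmul,
    detFunctional_wedge_tmul, hr, Finset.mul_sum, Finset.smul_sum]
  rw [Finset.sum_comm]
  refine Finset.sum_eq_zero fun a _ => ?_
  have := congrArg (r a * ·) (sum_detForm_removeNth_mul l v a)
  simp only [mul_zero, Finset.mul_sum] at this
  rw [← this]
  refine Finset.sum_congr rfl fun i _ => ?_
  rw [zsmul_eq_mul]
  push_cast
  ring

end Cycles

/-! ### Cohomology classes -/

section Classes

variable {k A : Type*} [Field k] [CommRing A] [Algebra k A]
  {𝒜 : ℤ → Submodule k A} [SetLike.GradedMonoid 𝒜] {d : ℕ} {b : ℤ} {p : ℕ} {q : ℤ}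

theorem representsNonzeroClass_of_notMem_koszulBoundaries {x : KoszulTerm 𝒜 d b p q}
    (hx : x ∈ koszulCycles 𝒜 d b p q) (hx' : x ∉ koszulBoundaries 𝒜 d b p q) :
    RepresentsNonzeroClass 𝒜 d b x :=
  ⟨hx, fun h => hx' ((Submodule.Quotient.mk_eq_zero
    ((koszulBoundaries 𝒜 d b p q).submoduleOf (koszulCycles 𝒜 d b p q))).1 h)⟩

theorem RepresentsNonzeroClass.nontrivial {x : KoszulTerm 𝒜 d b p q}
    (h : RepresentsNonzeroClass 𝒜 d b x) : Nontrivial (KoszulCohomology 𝒜 d b p q) :=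
  ⟨_, _, h.2⟩

theorem wedge_tmul_mem_koszulCycles (m : Fin p → 𝒜 (d : ℤ)) (f : 𝒜 (q * d + b))
    (h : ∀ i, (m i : A) * f = 0) : wedge k p m ⊗ₜ f ∈ koszulCycles 𝒜 d b p q := by
  cases p with
  | zero => trivial
  | succ p => exact koszulDifferential_eq_zero_of_annihilate _ _ _ _ fun i => Subtype.ext (h i)

/-- Multiplication of `𝒜_j ⊆ A` by an element of `A`. -/
def gradedMulLeft (𝒜 : ℤ → Submodule k A) (a : A) (j : ℤ) : 𝒜 j →ₗ[k] A :=
  LinearMap.mulLeft k a ∘ₗ (𝒜 j).subtype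

/-- Being a cycle can be tested after multiplying the coefficients by a nonzero element. -/
theorem mem_koszulCycles_of_map_gradedMulLeft [IsDomain A] {a : A} (ha : a ≠ 0)
    {z : KoszulTerm 𝒜 d b (p + 1) q}
    (hz : koszulDifferential ((LinearMap.mul k A).comp (𝒜 (d : ℤ)).subtype) p
      (TensorProduct.map (wedgeMap LinearMap.id (p + 1)) (gradedMulLeft 𝒜 a (q * d + b)) z) = 0) :
    z ∈ koszulCycles 𝒜 d b (p + 1) q := by
  have hinj : Function.Injective (TensorProduct.map
      (wedgeMap (LinearMap.id : 𝒜 (d : ℤ) →ₗ[k] _) p) (gradedMulLeft 𝒜 a ((q + 1) * d + b))) := by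
    rw [wedgeMap_id]
    exact Module.Flat.lTensor_preserves_injective_linearMap _
      fun x y hxy => Subtype.ext (mul_left_cancel₀ ha hxy)
  refine hinj ?_
  rw [map_zero, ← hz]
  have h : (d : ℤ) + (q * d + b) = (q + 1) * d + b := by ring
  exact (koszulDifferential_map (gradedMul 𝒜 h) ((LinearMap.mul k A).comp (𝒜 (d : ℤ)).subtype)
    LinearMap.id (gradedMulLeft 𝒜 a (q * d + b)) (gradedMulLeft 𝒜 a ((q + 1) * d + b))
    (fun v x => mul_left_comm a (v : A) (x : A)) p z).symm

end Classes

/-! ### Monomials of the truncated polynomial ring -/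

section Truncation

open MvPolynomial

variable {k : Type*} [Field k] {n d : ℕ}

theorem powerIdeal_eq_span_monomial : powerIdeal k n d =
    Ideal.span ((fun e => monomial e (1 : k)) '' Set.range fun i => Finsupp.single i d) := by
  rw [powerIdeal, ← Set.range_comp]
  simp only [Function.comp_def, X_pow_eq_monomial]

theorem coeff_eq_zero_of_mem_powerIdeal {e : Fin (n + 1) →₀ ℕ} (he : ∀ i, e i < d)
    {g : MvPolynomial (Fin (n + 1)) k} (hg : g ∈ powerIdeal k n d) : coeff e g = 0 := by
  by_contra h
  rw [powerIdeal_eq_span_monomial, mem_ideal_span_monomial_image] at hg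
  obtain ⟨_, ⟨i, rfl⟩, hi⟩ := hg e (mem_support_iff.2 h)
  have := hi i
  simp only [Finsupp.single_eq_same] at this
  exact absurd (he i) this.not_gt

theorem monomial_mem_powerIdeal {e : Fin (n + 1) →₀ ℕ} {i : Fin (n + 1)} (h : d ≤ e i) :
    monomial e (1 : k) ∈ powerIdeal k n d := by
  rw [powerIdeal_eq_span_monomial, mem_ideal_span_monomial_image]
  intro e' he'
  have : e' = e := by simpa using support_monomial_subset he'
  subst this
  exact ⟨_, ⟨i, rfl⟩, by simpa using h⟩

theorem mk_monomial_eq_zero_iff {e : Fin (n + 1) →₀ ℕ} :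
    Ideal.Quotient.mk (powerIdeal k n d) (monomial e 1) = 0 ↔ ∃ i, d ≤ e i := by
  rw [Ideal.Quotient.eq_zero_iff_mem]
  refine ⟨fun h => ?_, fun ⟨i, hi⟩ => monomial_mem_powerIdeal hi⟩
  by_contra! H
  simpa using coeff_eq_zero_of_mem_powerIdeal H h

/-- Composing the coefficient with a linear section of the projection defines a functional for every
`e`; the bound on `e` is needed only for independence of the representative. -/
theorem exists_truncCoeff (e : Fin (n + 1) →₀ ℕ) : ∃ c : TruncRing k n d →ₗ[k] k,
    (∀ i, e i < d) → ∀ g, c (Ideal.Quotient.mk (powerIdeal k n d) g) = coeff e g := by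
  obtain ⟨σ, hσ⟩ := LinearMap.exists_rightInverse_of_surjective
    (Ideal.Quotient.mkₐ k (powerIdeal k n d)).toLinearMap
    (LinearMap.range_eq_top.2 (Ideal.Quotient.mkₐ_surjective k _))
  refine ⟨lcoeff k e ∘ₗ σ, fun he g => ?_⟩
  have h : Ideal.Quotient.mk (powerIdeal k n d) (σ (Ideal.Quotient.mk (powerIdeal k n d) g)) =
      Ideal.Quotient.mk (powerIdeal k n d) g := LinearMap.congr_fun hσ _
  have := coeff_eq_zero_of_mem_powerIdeal he ((Ideal.Quotient.eq).1 h)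
  rw [coeff_sub, sub_eq_zero] at this
  exact this

/-- The coefficient of `x^e` as a functional on `S̄`; meaningful if all exponents are below `d`. -/
def truncCoeff (e : Fin (n + 1) →₀ ℕ) : TruncRing k n d →ₗ[k] k :=
  (exists_truncCoeff e).choose

theorem truncCoeff_mk {e : Fin (n + 1) →₀ ℕ} (he : ∀ i, e i < d)
    (g : MvPolynomial (Fin (n + 1)) k) :
    truncCoeff e (Ideal.Quotient.mk (powerIdeal k n d) g) = coeff e g :=
  (exists_truncCoeff e).choose_spec he g

theorem truncCoeff_eq_zero_of_weight_ne {e : Fin (n + 1) →₀ ℕ} (he : ∀ i, e i < d) {j : ℤ}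
    (hj : Finsupp.weight (fun _ => (1 : ℤ)) e ≠ j) {x : TruncRing k n d}
    (hx : x ∈ truncGrading k n d j) : truncCoeff e x = 0 := by
  obtain ⟨g, hg, rfl⟩ := hx
  exact (truncCoeff_mk he g).trans
    (((mem_weightedHomogeneousSubmodule k _ j g).1 hg).coeff_eq_zero e hj)

theorem monomial_mem_polyGrading {e : Fin (n + 1) →₀ ℕ} {j : ℤ}
    (h : Finsupp.weight (fun _ => (1 : ℤ)) e = j) : monomial e (1 : k) ∈ polyGrading k n j :=
  isWeightedHomogeneous_monomial _ _ _ h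

theorem IsMonomial.exists_exponent {j : ℤ} {x : TruncRing k n d} (h : IsMonomial x)
    (hx : x ∈ truncGrading k n d j) : ∃ e : Fin (n + 1) →₀ ℕ, (∀ i, e i < d) ∧
      Finsupp.weight (fun _ => (1 : ℤ)) e = j ∧
      x = Ideal.Quotient.mk (powerIdeal k n d) (monomial e 1) := by
  obtain ⟨h0, e, rfl⟩ := h
  have he : ∀ i, e i < d := by
    by_contra! H
    exact h0 (mk_monomial_eq_zero_iff.2 H)
  refine ⟨e, he, ?_, rfl⟩
  by_contra H
  have := truncCoeff_eq_zero_of_weight_ne he H hx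
  rw [truncCoeff_mk he] at this
  simp at this

theorem finite_setOf_isMonomial (j : ℤ) :
    {x : truncGrading k n d j | IsMonomial (x : TruncRing k n d)}.Finite := by
  refine Set.Finite.of_finite_image (f := Subtype.val) ?_ Subtype.val_injective.injOn
  refine ((Set.finite_Iic (Finsupp.equivFunOnFinite.symm fun _ : Fin (n + 1) => d)).image
    fun e => Ideal.Quotient.mk (powerIdeal k n d) (monomial e 1)).subset ?_
  rintro _ ⟨x, hx, rfl⟩
  obtain ⟨e, he, -, hxe⟩ := IsMonomial.exists_exponent hx x.2
  exact ⟨e, fun i => (he i).le, hxe.symm⟩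

theorem wedge_tmul_notMem_koszulBoundaries {b q : ℤ} {p : ℕ} {m : Fin p → truncGrading k n d d}
    (hinj : Function.Injective m) (hm : ∀ i, IsMonomial (m i : TruncRing k n d))
    {f : truncGrading k n d (q * d + b)} (hf : IsMonomial (f : TruncRing k n d))
    (hD : divisorMonomials (f : TruncRing k n d) ⊆ Set.range m) :
    wedge k p m ⊗ₜ f ∉ koszulBoundaries (truncGrading k n d) d b p q := by
  choose E hEd hEw hE using fun i => (hm i).exists_exponent (m i).2
  obtain ⟨a, had, haw, ha⟩ := hf.exists_exponent f.2
  have hEinj : Function.Injective E := fun i j hij =>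
    hinj (Subtype.ext (by rw [hE i, hE j, hij]))
  let l : Fin p → truncGrading k n d d →ₗ[k] k := fun i =>
    truncCoeff (E i) ∘ₗ (truncGrading k n d d).subtype
  let c : truncGrading k n d (q * d + b) →ₗ[k] k :=
    truncCoeff a ∘ₗ (truncGrading k n d (q * d + b)).subtype
  rintro ⟨y, hy⟩
  have hzero : detFunctional l c (wedge k p m ⊗ₜ f) = 0 := by
    rw [← hy]
    refine detFunctional_koszulDifferential _ l c (fun g => ?_) y
    obtain ⟨g, G, -, rfl⟩ := g
    -- The coefficient of `x^a` in a product is a sum over splittings of `a`; it remains to see that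
    -- each first factor contributes a functional in the span of `l`.
    suffices H : ∑ x ∈ Finset.HasAntidiagonal.antidiagonal a,
        coeff x.2 G • (truncCoeff x.1 ∘ₗ (truncGrading k n d d).subtype) ∈
          Submodule.span k (Set.range l) by
      obtain ⟨r, hr⟩ := (Submodule.mem_span_range_iff_exists_fun k).1 H
      refine ⟨r, fun v => ?_⟩
      have := LinearMap.congr_fun hr v
      simp only [LinearMap.sum_apply, LinearMap.smul_apply, smul_eq_mul] at this
      rw [this]
      obtain ⟨v, W, -, rfl⟩ := v
      change truncCoeff a (Ideal.Quotient.mk (powerIdeal k n d) W *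
        Ideal.Quotient.mk (powerIdeal k n d) G) = ∑ x ∈ Finset.HasAntidiagonal.antidiagonal a,
          coeff x.2 G * truncCoeff x.1 (Ideal.Quotient.mk (powerIdeal k n d) W)
      rw [← map_mul, truncCoeff_mk had, coeff_mul]
      refine Finset.sum_congr rfl fun x hx => ?_
      rw [truncCoeff_mk fun i => lt_of_le_of_lt (Finset.HasAntidiagonal.antidiagonal.fst_le hx i) (had i), mul_comm]
    refine Submodule.sum_mem _ fun x hx => Submodule.smul_mem _ _ ?_
    have hle : x.1 ≤ a := Finset.HasAntidiagonal.antidiagonal.fst_le hx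
    have hlt : ∀ i, x.1 i < d := fun i => lt_of_le_of_lt (hle i) (had i)
    -- In degree `d` the monomial `x^{x.1}` divides `f`, so it is some `m i`; in any other degree
    -- its coefficient functional vanishes on `S̄_d`.
    by_cases hw : Finsupp.weight (fun _ => (1 : ℤ)) x.1 = d
    · have hmem : (⟨Ideal.Quotient.mk (powerIdeal k n d) (monomial x.1 1),
          ⟨_, monomial_mem_polyGrading hw, rfl⟩⟩ : truncGrading k n d d) ∈
          divisorMonomials (f : TruncRing k n d) := by
        refine ⟨⟨?_, _, rfl⟩, ?_⟩
        · rw [Ne, mk_monomial_eq_zero_iff]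
          exact fun ⟨i, hi⟩ => absurd (hlt i) hi.not_gt
        · rw [ha]
          exact map_dvd _ ((monomial_dvd_monomial).2 ⟨Or.inr hle, one_dvd _⟩)
      obtain ⟨i, hi⟩ := hD hmem
      have hEi : E i = x.1 := by
        have h1 := congrArg (truncCoeff x.1) ((hE i).symm.trans (congrArg Subtype.val hi))
        rw [truncCoeff_mk hlt, truncCoeff_mk hlt] at h1
        by_contra hne
        simp [coeff_monomial, hne] at h1
      rw [← hEi]
      exact Submodule.subset_span ⟨i, rfl⟩
    · convert Submodule.zero_mem _
      ext v
      exact truncCoeff_eq_zero_of_weight_ne hlt hw v.2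
  have hone : detFunctional l c (wedge k p m ⊗ₜ f) = 1 := by
    have hc : c f = 1 := by
      change truncCoeff a (f : TruncRing k n d) = 1
      rw [ha, truncCoeff_mk had]
      simp
    have hl : (Matrix.of fun i j => l j (m i)) = (1 : Matrix (Fin p) (Fin p) k) := by
      ext i j
      change truncCoeff (E j) (m i : TruncRing k n d) = _
      rw [hE i, truncCoeff_mk (hEd j), coeff_monomial, Matrix.one_apply]
      simp [hEinj.eq_iff]
    rw [detFunctional_wedge_tmul, hc, detForm_apply, hl, Matrix.det_one, mul_one]
  exact one_ne_zero (hone.symm.trans hzero)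

end Truncation

/-! ### Lifting to the polynomial ring -/

section Lift

open MvPolynomial

variable {k : Type*} [Field k] {n : ℕ}

/-- The projection `S_j → S̄_j`. -/
def truncMap (d : ℕ) (j : ℤ) : polyGrading k n j →ₗ[k] truncGrading k n d j :=
  (Ideal.Quotient.mkₐ k (powerIdeal k n d)).toLinearMap.submoduleMap (polyGrading k n j)

variable {d : ℕ}

theorem map_truncMap_mem_koszulBoundaries {b q : ℤ} {p : ℕ}
    {z : KoszulTerm (polyGrading k n) d b p q}
    (hz : z ∈ koszulBoundaries (polyGrading k n) d b p q) :
    TensorProduct.map (wedgeMap (truncMap d d) p) (truncMap d (q * d + b)) z ∈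
      koszulBoundaries (truncGrading k n d) d b p q := by
  obtain ⟨y, rfl⟩ := hz
  have h : (d : ℤ) + ((q - 1) * d + b) = q * d + b := by ring
  exact ⟨_, koszulDifferential_map (gradedMul (polyGrading k n) h)
    (gradedMul (truncGrading k n d) h) (truncMap d d) (truncMap d ((q - 1) * d + b))
    (truncMap d (q * d + b)) (fun v m => Subtype.ext (map_mul
      (Ideal.Quotient.mkₐ k (powerIdeal k n d)) (v : MvPolynomial (Fin (n + 1)) k) m)) p y⟩

/-- Injectivity lets each variable occur at most once on the left, so a single `hj i` bounds its
exponent. This makes the truncated subtraction of exponents in `exists_cycle_lift` a genuine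
division. -/
theorem sum_single_le {p : ℕ} {a : Fin (n + 1) →₀ ℕ} {e : Fin p → Fin (n + 1) →₀ ℕ}
    {j : Fin p → Fin (n + 1)} (hj : ∀ i, d ≤ (e i + a) (j i)) {I : Finset (Fin p)}
    (hI : Set.InjOn j I) : ∑ i ∈ I, Finsupp.single (j i) d ≤ a + ∑ i ∈ I, e i := by
  intro t
  simp only [Finsupp.finsetSum_apply, Finsupp.add_apply] at hj ⊢
  by_cases ht : ∃ i ∈ I, j i = t
  · obtain ⟨i, hi, rfl⟩ := ht
    rw [Finset.sum_eq_single_of_mem i hi fun i' hi' hne =>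
      Finsupp.single_eq_of_ne fun h => hne (hI hi' hi h.symm), Finsupp.single_eq_same]
    have := Finset.single_le_sum (f := fun i' => e i' (j i)) (fun _ _ => Nat.zero_le _) hi
    have := hj i
    omega
  · rw [Finset.sum_eq_zero fun i hi => Finsupp.single_eq_of_ne fun h => ht ⟨i, hi, h.symm⟩]
    exact Nat.zero_le _

theorem exists_cycle_lift {b q : ℤ} {p : ℕ} {m : Fin p → truncGrading k n d d}
    (hm : ∀ i, IsMonomial (m i : TruncRing k n d))
    {f : truncGrading k n d (q * d + b)} (hf : IsMonomial (f : TruncRing k n d))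
    (hZ : ∀ i, (m i : TruncRing k n d) * f = 0) :
    ∃ z ∈ koszulCycles (polyGrading k n) d b p q,
      TensorProduct.map (wedgeMap (truncMap d d) p) (truncMap d (q * d + b)) z =
        wedge k p m ⊗ₜ f := by
  classical
  choose E hEd hEw hE using fun i => (hm i).exists_exponent (m i).2
  obtain ⟨a, had, haw, ha⟩ := hf.exists_exponent f.2
  have hj' : ∀ i, ∃ j, d ≤ (E i + a) j := fun i => by
    have := hZ i
    rw [hE i, ha, ← map_mul, monomial_mul, one_mul] at this
    exact mk_monomial_eq_zero_iff.1 this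
  choose j hj using hj'
  have hXw : ∀ i, Finsupp.weight (fun _ => (1 : ℤ)) (Finsupp.single (j i) d) = d := fun i => by
    simp [Finsupp.weight_single]
  let M : Fin p → polyGrading k n d := fun i => ⟨_, monomial_mem_polyGrading (hEw i)⟩
  let X : Fin p → polyGrading k n d := fun i => ⟨_, monomial_mem_polyGrading (hXw i)⟩
  have hw : ∀ I : Finset (Fin p), Set.InjOn j I → Finsupp.weight (fun _ => (1 : ℤ))
      (a + ∑ i ∈ I, E i - ∑ i ∈ I, Finsupp.single (j i) d) = q * d + b := fun I hI => by
    have := congrArg (Finsupp.weight (fun _ => (1 : ℤ)))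
      (tsub_add_cancel_of_le (sum_single_le hj hI))
    simp only [map_add, map_sum, hEw, hXw, haw] at this
    linarith
  -- The coefficient is `f ∏ m_i / ∏ X_i` over `i ∈ I`. If `j` is not injective on `I`, the wedge
  -- repeats some `X i`, so the default value 0 is harmless.
  let C : Finset (Fin p) → polyGrading k n (q * d + b) := fun I =>
    if hI : Set.InjOn j I then ⟨_, monomial_mem_polyGrading (hw I hI)⟩ else 0
  let z : KoszulTerm (polyGrading k n) d b p q := ∑ I : Finset (Fin p), (-1 : ℤ) ^ I.card •
    (wedge k p (fun i => if i ∈ I then X i else M i) ⊗ₜ[k] C I)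
  -- Multiplying by the product of all `X i` clears the denominators and turns `z` into the cycle of
  -- `koszulDifferential_sum_ite`.
  let N : MvPolynomial (Fin (n + 1)) k := ∏ i, (X i : MvPolynomial (Fin (n + 1)) k)
  have hN : N ≠ 0 := Finset.prod_ne_zero_iff.2 fun i _ => by simp [X]
  have hterm : ∀ I : Finset (Fin p), Set.InjOn j I → gradedMulLeft (polyGrading k n) N _ (C I) = monomial a 1 *
      ∏ i, if i ∈ I then (M i : MvPolynomial (Fin (n + 1)) k) else X i := fun I hI => by
    have h1 : (∏ i ∈ I, (X i : MvPolynomial (Fin (n + 1)) k)) * (C I : MvPolynomial (Fin (n + 1)) k) =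
        monomial a 1 * ∏ i ∈ I, (M i : MvPolynomial (Fin (n + 1)) k) := by
      simp only [C, X, M, dif_pos hI, ← monomial_sum_one, monomial_mul, mul_one]
      rw [add_tsub_cancel_of_le (sum_single_le hj hI)]
    have h2 : N = (∏ i ∈ I, (X i : MvPolynomial (Fin (n + 1)) k)) *
        ∏ i ∈ Iᶜ, (X i : MvPolynomial (Fin (n + 1)) k) := (Finset.prod_mul_prod_compl _ _).symm
    have h3 : (∏ i, if i ∈ I then (M i : MvPolynomial (Fin (n + 1)) k) else X i) =
        (∏ i ∈ I, (M i : MvPolynomial (Fin (n + 1)) k)) *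
          ∏ i ∈ Iᶜ, (X i : MvPolynomial (Fin (n + 1)) k) := by
      rw [← Finset.prod_mul_prod_compl I]
      congr 1
      · exact Finset.prod_congr rfl fun i hi => if_pos hi
      · exact Finset.prod_congr rfl fun i hi => if_neg (Finset.mem_compl.1 hi)
    change N * (C I : MvPolynomial (Fin (n + 1)) k) = _
    rw [h2, h3, mul_right_comm, h1, mul_assoc]
  have hmap : TensorProduct.map (wedgeMap LinearMap.id p) (gradedMulLeft (polyGrading k n) N (q * d + b)) z =
      ∑ I : Finset (Fin p), (-1 : ℤ) ^ I.card •
        (wedge k p (fun i => if i ∈ I then X i else M i) ⊗ₜ[k]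
          (monomial a 1 * ∏ i, if i ∈ I then (polyGrading k n d).subtype (M i)
            else (polyGrading k n d).subtype (X i))) := by
    simp only [z, map_sum, map_zsmul]
    refine Finset.sum_congr rfl fun I _ => ?_
    congr 1
    by_cases hI : Set.InjOn j I
    · rw [TensorProduct.map_tmul, wedgeMap_id, hterm I hI]
      rfl
    · have h0 : wedge k p (fun i => if i ∈ I then X i else M i) = 0 := by
        simp only [Set.InjOn, not_forall] at hI
        obtain ⟨s, hs, t, ht, hst, hne⟩ := hI
        refine (wedge k p).map_eq_zero_of_eq _ (i := s) (j := t) ?_ hne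
        rw [if_pos (Finset.mem_coe.1 hs), if_pos (Finset.mem_coe.1 ht)]
        simp only [X, hst]
      simp [h0]
  refine ⟨z, ?_, ?_⟩
  · clear_value z
    cases p with
    | zero => trivial
    | succ p =>
      refine mem_koszulCycles_of_map_gradedMulLeft hN ?_
      rw [hmap]
      exact koszulDifferential_sum_ite (polyGrading k n d).subtype p X M _
  · simp only [z, map_sum, map_zsmul, TensorProduct.map_tmul, wedgeMap_wedge]
    -- Each `X i` is a `d`-th power of a variable and dies in `S̄`, so only the term with no `X i`
    -- survives.
    rw [Finset.sum_eq_single ∅]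
    · have h1 : truncMap d (q * d + b) (C ∅) = f := Subtype.ext <| by
        rw [ha]
        simp [C, truncMap]
        rfl
      have h2 : ∀ i, truncMap d d (M i) = m i := fun i => Subtype.ext (hE i).symm
      simp [h1, h2]
    · intro I _ hI
      obtain ⟨i, hi⟩ := Finset.nonempty_iff_ne_empty.2 hI
      rw [(wedge k p).map_coord_zero i, TensorProduct.zero_tmul, smul_zero]
      rw [if_pos hi]
      exact Subtype.ext (Ideal.Quotient.eq_zero_iff_mem.2
        (monomial_mem_powerIdeal (i := j i) (by simp)))
    · simp

end Lift

end Veronese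

end

/-! ### The nonvanishing theorem -/

theorem corollary1p3 {k : Type*} [Field k] (n d : ℕ) (hd : 1 ≤ d) (b q : ℤ)
    (f : Veronese.truncGrading k n d (q * d + b))
    (hf : Veronese.IsMonomial (f : Veronese.TruncRing k n d))
    (hDZ : Veronese.divisorMonomials (f : Veronese.TruncRing k n d) ⊆
      Veronese.annihilatorMonomials (f : Veronese.TruncRing k n d)) :
    (∀ (δ : Fin (Veronese.divisorMonomials (f : Veronese.TruncRing k n d)).ncard ≃
          Veronese.divisorMonomials (f : Veronese.TruncRing k n d))
        (s : ℕ) (ζ : Fin s → Veronese.annihilatorMonomials (f : Veronese.TruncRing k n d))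
        (x : Veronese.KoszulTerm (Veronese.truncGrading k n d) d b
          ((Veronese.divisorMonomials (f : Veronese.TruncRing k n d)).ncard + s) q),
        x = Veronese.wedge k _
          (Fin.append (fun i => (δ i : Veronese.truncGrading k n d d)) (fun i => (ζ i).1)) ⊗ₜ[k] f →
        x ≠ 0 →
        Veronese.RepresentsNonzeroClass (Veronese.truncGrading k n d) d b x) ∧
    (∀ p : ℕ, (Veronese.divisorMonomials (f : Veronese.TruncRing k n d)).ncard ≤ p →
        p ≤ (Veronese.annihilatorMonomials (f : Veronese.TruncRing k n d)).ncard →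
        Nontrivial (Veronese.VeroneseKoszul k n b d p q)) := by
  open Veronese in
  constructor
  · rintro δ s ζ x rfl hx
    set m := Fin.append (fun i => (δ i : truncGrading k n d d)) (fun i => (ζ i).1) with hm
    have hmZ : ∀ i, m i ∈ annihilatorMonomials (f : TruncRing k n d) := fun i => by
      refine Fin.addCases (fun i => ?_) (fun i => ?_) i
      · rw [hm, Fin.append_left]
        exact hDZ (δ i).2
      · rw [hm, Fin.append_right]
        exact (ζ i).2
    refine representsNonzeroClass_of_notMem_koszulBoundaries
      (wedge_tmul_mem_koszulCycles m f fun i => (hmZ i).2)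
      (wedge_tmul_notMem_koszulBoundaries ?_ (fun i => (hmZ i).1) hf fun y hy => ?_)
    -- A repeated factor would make the wedge, and so the element, zero.
    · by_contra hinj
      rw [(wedge k _).map_eq_zero_of_not_injective m hinj, TensorProduct.zero_tmul] at hx
      exact hx rfl
    · refine ⟨Fin.castAdd s (δ.symm ⟨y, hy⟩), ?_⟩
      rw [hm, Fin.append_left, Equiv.apply_symm_apply]
  · intro p hp hp'
    obtain ⟨T, hDT, hTZ, hT⟩ := Set.exists_subsuperset_card_eq hDZ hp hp'
    -- Since `ncard` is 0 on infinite sets, `hT` alone does not give finiteness; there are only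
    -- finitely many monomials of degree `d`.
    have : Finite T := ((finite_setOf_isMonomial (d : ℤ)).subset fun _ hx => (hTZ hx).1).to_subtype
    let σ : Fin p ≃ T := (Finite.equivFinOfCardEq ((Nat.card_coe_set_eq T).trans hT)).symm
    have hσ : ∀ i, (σ i : truncGrading k n d d) ∈ annihilatorMonomials (f : TruncRing k n d) :=
      fun i => hTZ (σ i).2
    obtain ⟨z, hz, hzm⟩ := exists_cycle_lift (b := b) (q := q) (m := fun i => (σ i).1)
      (fun i => (hσ i).1) hf fun i => (hσ i).2
    refine (representsNonzeroClass_of_notMem_koszulBoundaries hz fun hzb => ?_).nontrivial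
    refine wedge_tmul_notMem_koszulBoundaries (m := fun i => (σ i).1)
      (Subtype.val_injective.comp σ.injective) (fun i => (hσ i).1) hf (fun y hy => ?_)
      (hzm ▸ map_truncMap_mem_koszulBoundaries hzb)
    exact ⟨σ.symm ⟨y, hDT hy⟩, by simp⟩
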